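/- Let $G=(V,E)$ be a finite connected graph cellularly embedded in a connected compact orientable boundaryless surface $\Sigma$ of genus $g\ge 0$ (every face is an open disc), let $G^*=(V^*,E^*)$ be its dual graph (edges $e\in E$ and dual edges $e^*\in E^*$ are in bijection), and let $(J_{e^*})_{e^*\in E^*}$ be positive coupling constants. A polygon configuration of $G$ (resp. $G^*$) is a set of edges such that every vertex is incident to an even number of them (loops counted twice). For $\varepsilon\in H_1(\Sigma,\mathbb Z/2\mathbb Z)$, $\mathcal P^\varepsilon(G)$ (resp. $\mathcal P^\varepsilon(G^*)$) is the set of those of homology class $\varepsilon$. Fix for every $\varepsilon$ a representative $\hat\varepsilon\in\mathcal P^\varepsilon(G)$. The Ising model on $G^*$ with defect condition $\varepsilon$ has partition function $$Z^\varepsilon=\sum_{\sigma\in\{-1,1\}^{V^*}}\exp\Bigl(\sum_{e^*=u^*v^*\in E^*}\pm J_{e^*}\sigma_{u^*}\sigma_{v^*}\Bigr),$$ with sign $-$ exactly when $e\in\hat\varepsilon$. The low-temperature configuration of a spin configuration $\sigma$ is the symmetric difference of $\hat\varepsilon$ with the set of edges $e$ such that $\sigma_{u^*}\ne\sigma_{v^*}$,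 where $e^*=u^*v^*$. The double Ising measure $\mathbb P$ is the probability measure on $\mathfrak P=\bigcup_{\varepsilon}\mathcal P^\varepsilon(G)\times\mathcal P^\varepsilon(G)$ giving $(P_{\rm red},P_{\rm blue})$ the probability $\mathcal C\prod_{e\in P_{\rm red}}e^{-2J_{e^*}}\prod_{e\in P_{\rm blue}}e^{-2J_{e^*}}/Z(G^*,J)$, where $\mathcal C=\bigl(2\prod_{e\in E}e^{J_{e^*}}\bigr)^2$ and the normalization $$Z(G^*,J)=\sum_{\varepsilon\in H_1(\Sigma,\mathbb Z/2\mathbb Z)}\ \sum_{(P_{\rm red},P_{\rm blue})\in\mathcal P^\varepsilon(G)\times\mathcal P^\varepsilon(G)}\mathcal C\prod_{e\in P_{\rm red}}e^{-2J_{e^*}}\prod_{e\in P_{\rm blue}}e^{-2J_{e^*}}$$ is the double Ising partition function. For $(P_{\rm red},P_{\rm blue})\in\mathcal P^\varepsilon(G)\times\mathcal P^\varepsilon(G)$, the XOR loop configuration $\mathrm{XOR}(P_{\rm red},P_{\rm blue})$ is the set of edges $e$ of $G$ such that the product $\sigma\sigma'$ takes different values at the two ends of $e^*$, where $\sigma,\sigma'$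 are spin configurations whose low-temperature configurations (with defect $\hat\varepsilon$) are $P_{\rm red}$ and $P_{\rm blue}$. Then $Z(G^*,J)=\sum_{\varepsilon}(Z^{\varepsilon})^2$; $\mathrm{XOR}$ is well defined on $\mathfrak P$, with set of values $\mathcal P^0(G)$; and: 1. $$Z(G^*,J)=\mathcal C_I\sum_{\substack{(P,P^*)\in\mathcal P^0(G)\times\mathcal P^0(G^*)\\ P\cap P^*=\emptyset}}\Bigl(\prod_{e\in P}\frac{2e^{-2J_{e^*}}}{1+e^{-4J_{e^*}}}\Bigr)\Bigl(\prod_{e^*\in P^*}\frac{1-e^{-4J_{e^*}}}{1+e^{-4J_{e^*}}}\Bigr),\qquad \mathcal C_I=2^{|V^*|+2g+1}\prod_{e\in E}\cosh(2J_{e^*}),$$ where $P\cap P^*=\emptyset$ means that there is no edge $e$ with $e\in P$ and $e^*\in P^*$. 2. For every $P\in\mathcal P^0(G)$, $$\mathbb P[\mathrm{XOR}=P]=\frac{\displaystyle\Bigl(\prod_{e\in P}\frac{2e^{-2J_{e^*}}}{1+e^{-4J_{e^*}}}\Bigr)\sum_{\substack{P^*\in\mathcal P^0(G^*)\\ P\cap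 P^*=\emptyset}}\ \prod_{e^*\in P^*}\frac{1-e^{-4J_{e^*}}}{1+e^{-4J_{e^*}}}}{\displaystyle\sum_{\substack{(Q,Q^*)\in\mathcal P^0(G)\times\mathcal P^0(G^*)\\ Q\cap Q^*=\emptyset}}\Bigl(\prod_{e\in Q}\frac{2e^{-2J_{e^*}}}{1+e^{-4J_{e^*}}}\Bigr)\Bigl(\prod_{e^*\in Q^*}\frac{1-e^{-4J_{e^*}}}{1+e^{-4J_{e^*}}}\Bigr)}.$$ -/

import Mathlib

/-- Reversal of darts: the dart `(e, b)` is the edge `e` with one of its two orientations. -/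
def dartFlip (E : Type*) : Equiv.Perm (E × Bool) :=
  (Equiv.refl E).prodCongr Equiv.boolNot

/-- A graph with vertices `V` and edges `E` (loops and multiple edges allowed), cellularly embedded
in a connected closed oriented surface with set of faces `F`, encoded by its rotation system
(combinatorial map).  Every edge has two darts `(e, false)` and `(e, true)`; `rot` sends a dart to
the next dart around the same vertex in the cyclic order given by the orientation of the surface.
Vertices are the cycles of `rot`, and following a dart to its end and then applying `rot` runs
along the boundary of a face, so that faces are the cycles of `rot ∘ flip`; `face d` is the face
bordered by `d` on one fixed side, and `face (flip d)` is the face on the other side of the same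
edge.  The two connectedness conditions say that the surface is connected; they also allow the
map without edges, that is one vertex on the sphere, and no other vertex or face without darts. -/
structure CellularEmbedding (V E F : Type*) where
  rot : Equiv.Perm (E × Bool)
  origin : E × Bool → V
  face : E × Bool → F
  origin_eq_iff : ∀ d d₁ : E × Bool, origin d = origin d₁ ↔ rot.SameCycle d d₁
  face_eq_iff : ∀ d d₁ : E × Bool, face d = face d₁ ↔ (rot * dartFlip E).SameCycle d d₁
  connected : (SimpleGraph.fromRel
    (fun u v : V => ∃ d, origin d = u ∧ origin (dartFlip E d) = v)).Connected
  dual_connected : (SimpleGraph.fromRel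
    (fun u v : F => ∃ d, face d = u ∧ face (dartFlip E d) = v)).Connected

namespace CellularEmbedding

theorem dartFlip_mul_self (E : Type*) : dartFlip E * dartFlip E = 1 := by
  ext ⟨e, b⟩ <;> simp [dartFlip]

/-- The dual graph `G*`, embedded in the same surface: its vertices are the faces of `G`, its faces
are the vertices of `G`, and `e*` is identified with `e`.  The dual of the dart `d` crosses `d`
from the face `face d` to the face `face (flip d)`. -/
def dual {V E F : Type*} (M : CellularEmbedding V E F) : CellularEmbedding F E V where
  rot := M.rot * dartFlip E
  origin := M.face
  face := M.origin
  origin_eq_iff := M.face_eq_iff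
  face_eq_iff := by
    rw [mul_assoc, dartFlip_mul_self, mul_one]
    exact M.origin_eq_iff
  connected := M.dual_connected
  dual_connected := M.connected

/-- The surface has genus `g`, by Euler's formula `|V| - |E| + |F| = 2 - 2g`. -/
def HasGenus {V E F : Type*} [Fintype V] [Fintype E] [Fintype F]
    (_M : CellularEmbedding V E F) (g : ℕ) : Prop :=
  (Fintype.card V : ℤ) - Fintype.card E + Fintype.card F = 2 - 2 * (g : ℤ)

/-! ### Cellular homology of the surface with coefficients in `ℤ/2ℤ` -/

/-- The boundary operator from 1-chains to 0-chains: every edge goes to the sum of its ends. -/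
def boundaryOne {V E F : Type*} [Fintype E] [DecidableEq V]
    (M : CellularEmbedding V E F) : (E → ZMod 2) →ₗ[ZMod 2] (V → ZMod 2) where
  toFun c v := ∑ d : E × Bool, if M.origin d = v then c d.1 else 0
  map_add' a b := by
    funext v
    simp only [Pi.add_apply, ← Finset.sum_add_distrib]
    refine Finset.sum_congr rfl fun d _ => ?_
    split_ifs <;> simp
  map_smul' a b := by
    funext v
    simp only [Pi.smul_apply, smul_eq_mul, RingHom.id_apply, Finset.mul_sum]
    refine Finset.sum_congr rfl fun d _ => ?_
    split_ifs <;> simp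

/-- The boundary operator from 2-chains to 1-chains: every face goes to the sum of the edges on its
boundary, an edge with this face on both sides being counted twice. -/
def boundaryTwo {V E F : Type*}
    (M : CellularEmbedding V E F) : (F → ZMod 2) →ₗ[ZMod 2] (E → ZMod 2) where
  toFun c e := c (M.face (e, false)) + c (M.face (e, true))
  map_add' a b := by
    funext e
    simp only [Pi.add_apply]
    ring
  map_smul' a b := by
    funext e
    simp only [Pi.smul_apply, smul_eq_mul, RingHom.id_apply]
    ring

theorem face_flip_eq {V E F : Type*} (M : CellularEmbedding V E F) (d : E × Bool) :
    M.face (dartFlip E d) = M.face (M.rot d) := by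
  rw [M.face_eq_iff]
  refine ⟨1, ?_⟩
  have h : dartFlip E (dartFlip E d) = d := by
    rw [← Equiv.Perm.mul_apply, dartFlip_mul_self, Equiv.Perm.one_apply]
  rw [zpow_one, Equiv.Perm.mul_apply, h]

/-- The boundary of a boundary vanishes. -/
theorem boundaryOne_boundaryTwo {V E F : Type*} [Fintype E] [DecidableEq V]
    (M : CellularEmbedding V E F) (c : F → ZMod 2) :
    M.boundaryOne (M.boundaryTwo c) = 0 := by
  funext v
  have h1 : ∀ d : E × Bool,
      M.boundaryTwo c d.1 = c (M.face d) + c (M.face (M.rot d)) := by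
    rintro ⟨e, b⟩
    rw [← face_flip_eq]
    cases b
    · rfl
    · exact add_comm _ _
  have h2 : ∀ d : E × Bool, M.origin (M.rot d) = M.origin d := fun d =>
    (M.origin_eq_iff _ _).2 ⟨-1, by simp⟩
  have h3 : (∑ d : E × Bool, if M.origin d = v then c (M.face (M.rot d)) else 0)
      = ∑ d : E × Bool, if M.origin d = v then c (M.face d) else 0 := by
    rw [← Equiv.sum_comp M.rot (fun d => if M.origin d = v then c (M.face d) else 0)]
    simp only [h2]
  have h4 : M.boundaryOne (M.boundaryTwo c) v
      = (∑ d : E × Bool, if M.origin d = v then c (M.face d) else 0)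
        + ∑ d : E × Bool, if M.origin d = v then c (M.face (M.rot d)) else 0 := by
    rw [← Finset.sum_add_distrib]
    refine Finset.sum_congr rfl fun d _ => ?_
    simp only [h1]
    split_ifs <;> simp
  rw [h4, h3]
  exact CharTwo.add_self_eq_zero _

/-- The first homology group `H₁(Σ, ℤ/2ℤ)` of the surface: 1-cycles modulo boundaries. -/
abbrev Homology {V E F : Type*} [Fintype E] [DecidableEq V] (M : CellularEmbedding V E F) :=
  LinearMap.ker M.boundaryOne ⧸
    (LinearMap.range M.boundaryTwo).submoduleOf (LinearMap.ker M.boundaryOne)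

noncomputable instance {V E F : Type*} [Fintype E] [DecidableEq V]
    (M : CellularEmbedding V E F) : Fintype M.Homology :=
  haveI : Finite (LinearMap.ker M.boundaryOne) := Subtype.finite
  haveI : Finite M.Homology := Finite.of_surjective _ (Submodule.Quotient.mk_surjective _)
  Fintype.ofFinite _

/-! ### Polygon configurations -/

/-- A polygon configuration: a set of edges such that every vertex is incident to an even number of
them, loops being counted twice. -/
def IsPolygon {V E F : Type*} [Fintype E] [DecidableEq V] [DecidableEq E]
    (M : CellularEmbedding V E F) (P : Finset E) : Prop :=
  ∀ v : V, Even (Finset.card {d : E × Bool | M.origin d = v ∧ d.1 ∈ P})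

/-- The 1-chain with coefficients in `ℤ/2ℤ` associated with a set of edges. -/
def chain {E : Type*} [DecidableEq E] (P : Finset E) : E → ZMod 2 :=
  fun e => if e ∈ P then 1 else 0

theorem IsPolygon.chain_mem_ker {V E F : Type*} [Fintype E] [DecidableEq V] [DecidableEq E]
    {M : CellularEmbedding V E F} {P : Finset E} (h : M.IsPolygon P) :
    chain P ∈ LinearMap.ker M.boundaryOne := by
  rw [LinearMap.mem_ker]
  funext v
  have h1 : M.boundaryOne (chain P) v
      = ((Finset.card {d : E × Bool | M.origin d = v ∧ d.1 ∈ P} : ℕ) : ZMod 2) := by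
    rw [Finset.natCast_card_filter]
    refine Finset.sum_congr rfl fun d _ => ?_
    rw [ite_and]
    rfl
  rw [h1]
  exact (ZMod.natCast_eq_zero_iff_even).2 (h v)

/-- The homology class of a polygon configuration. -/
def IsPolygon.homologyClass {V E F : Type*} [Fintype E] [DecidableEq V] [DecidableEq E]
    {M : CellularEmbedding V E F} {P : Finset E} (h : M.IsPolygon P) : M.Homology :=
  Submodule.Quotient.mk ⟨chain P, h.chain_mem_ker⟩

open Classical in
/-- The set `𝒫^ε(G)` of polygon configurations of homology class `ε`. -/
noncomputable def polygons {V E F : Type*} [Fintype E] [DecidableEq V] [DecidableEq E]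
    (M : CellularEmbedding V E F) (ε : M.Homology) : Finset (Finset E) :=
  {P | ∃ h : M.IsPolygon P, h.homologyClass = ε}

/-! ### Ising models on the dual graph -/

/-- The partition function of the Ising model on `G*` with spins `±1` at the faces of `G` and
coupling constants `J`, negated at the edges dual to those of the defect set `D`. -/
noncomputable def isingPartition {V E F : Type*} [Fintype E] [Fintype F] [DecidableEq E]
    [DecidableEq F] (M : CellularEmbedding V E F) (J : E → ℝ) (D : Finset E) : ℝ :=
  ∑ s : F → ℤˣ, Real.exp (∑ e : E, (if e ∈ D then -J e else J e) *
    ((s (M.face (e, false)) : ℤ) : ℝ) * ((s (M.face (e, true)) : ℤ) : ℝ))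

/-- The edges of `G` separating faces with different spins. -/
def domainWall {V E F : Type*} [Fintype E] (M : CellularEmbedding V E F) (s : F → ℤˣ) :
    Finset E :=
  {e | s (M.face (e, false)) ≠ s (M.face (e, true))}

/-- The polygon configuration of the low-temperature expansion of the Ising model with defect set
`D`: the state of every edge of `D` is switched in the domain wall. -/
def lowTemp {V E F : Type*} [Fintype E] [DecidableEq E] (M : CellularEmbedding V E F)
    (D : Finset E) (s : F → ℤˣ) : Finset E :=
  symmDiff (M.domainWall s) D

/-! ### The double Ising model -/

/-- The pairs of red and blue polygon configurations with the same homology class. -/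
noncomputable def doublePairs {V E F : Type*} [Fintype E] [DecidableEq V] [DecidableEq E]
    (M : CellularEmbedding V E F) : Finset (Finset E × Finset E) :=
  Finset.univ.biUnion fun ε : M.Homology => M.polygons ε ×ˢ M.polygons ε

/-- The weight `𝒞 ∏_{e ∈ P_red} e^{-2J} ∏_{e ∈ P_blue} e^{-2J}`, `𝒞 = (2 ∏_{e ∈ E} e^J)²`. -/
noncomputable def doubleWeight {E : Type*} [Fintype E] (J : E → ℝ) (p : Finset E × Finset E) : ℝ :=
  (2 * ∏ e : E, Real.exp (J e)) ^ 2 * (∏ e ∈ p.1, Real.exp (-2 * J e)) *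
    ∏ e ∈ p.2, Real.exp (-2 * J e)

/-- The double Ising partition function. -/
noncomputable def doublePartition {V E F : Type*} [Fintype E] [DecidableEq V] [DecidableEq E]
    (M : CellularEmbedding V E F) (J : E → ℝ) : ℝ :=
  ∑ ε : M.Homology, ∑ p ∈ M.polygons ε ×ˢ M.polygons ε, doubleWeight J p

/-- `P` is an XOR loop configuration of the pair `p` of red and blue polygon configurations: for
spin configurations `s` and `t` whose low-temperature expansions are `p.1` and `p.2`, with the
defects given by the chosen representative `rep ε` of their class `ε`, the set `P` separates the
clusters of equal spins of the product `s * t`. -/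
def IsXorLoop {V E F : Type*} [Fintype E] [DecidableEq V] [DecidableEq E]
    (M : CellularEmbedding V E F) (rep : M.Homology → Finset E) (p : Finset E × Finset E)
    (P : Finset E) : Prop :=
  ∃ ε : M.Homology, p.1 ∈ M.polygons ε ∧ p.2 ∈ M.polygons ε ∧
    ∃ s t : F → ℤˣ, M.lowTemp (rep ε) s = p.1 ∧ M.lowTemp (rep ε) t = p.2 ∧
      M.domainWall (s * t) = P

open Classical in
/-- The probability, under the double Ising measure, that the XOR loop configuration is `P`. -/
noncomputable def xorProb {V E F : Type*} [Fintype E] [DecidableEq V] [DecidableEq E]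
    (M : CellularEmbedding V E F) (J : E → ℝ) (rep : M.Homology → Finset E) (P : Finset E) : ℝ :=
  ∑ p ∈ M.doublePairs with M.IsXorLoop rep p P, doubleWeight J p / M.doublePartition J

/-! ### Weights of the mixed contour expansion -/

/-- The product over `e ∈ P` of `2e^{-2J} / (1 + e^{-4J})`. -/
noncomputable def primalWeight {E : Type*} (J : E → ℝ) (P : Finset E) : ℝ :=
  ∏ e ∈ P, 2 * Real.exp (-2 * J e) / (1 + Real.exp (-4 * J e))

/-- The product over `e* ∈ Q` of `(1 - e^{-4J}) / (1 + e^{-4J})`. -/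
noncomputable def dualWeight {E : Type*} (J : E → ℝ) (Q : Finset E) : ℝ :=
  ∏ e ∈ Q, (1 - Real.exp (-4 * J e)) / (1 + Real.exp (-4 * J e))

/-- The sum over the pairs `(P, P*) ∈ 𝒫⁰(G) × 𝒫⁰(G*)` with `P ∩ P* = ∅`, where an edge and its dual
edge are identified. -/
noncomputable def mixedSum {V E F : Type*} [Fintype E] [DecidableEq V] [DecidableEq E]
    [DecidableEq F] (M : CellularEmbedding V E F) (J : E → ℝ) : ℝ :=
  ∑ q ∈ M.polygons 0 ×ˢ M.dual.polygons 0 with Disjoint q.1 q.2,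
    primalWeight J q.1 * dualWeight J q.2

end CellularEmbedding

/-!
The set `𝒫^ε(G)` is a coset, in the space of 1-cycles modulo 2, of the space of boundaries of
2-chains.  A 2-chain modulo 2 is the same as a spin configuration on the faces, and its boundary is
the domain wall of the spins (`exists_domainWall_iff`).  Hence the low-temperature expansion with
defect set `D` maps the spin configurations onto the class of `D`, and, the surface being connected,
this map is two-to-one (`sum_lowTemp`).  This expresses the double Ising partition function through
the Ising models with defects.

The XOR loop configuration of a pair `(R, B)` is the symmetric difference `P = R ∆ B`
(`isXorLoop_iff`), so that a pair in `𝔓` amounts to a polygon configuration `R` of any class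
together with an element `P` of `𝒫⁰(G)` (`mem_doublePairs_iff_symmDiff`).  It remains to sum the
weight over `R` for fixed `P`.  This weight is a product over the edges, and the constraint that `R`
is a polygon configuration is resolved by Poisson summation: averaging over the spins at the
vertices of `G` the product of the spins at the ends of the edges of `R` yields the indicator of this
constraint (`sum_prod_spins`).  That product is the character `(-1)^|R ∩ Q|`, where `Q` is the domain
wall of the spins in the dual map, and `Q` runs twice through `𝒫⁰(G*)`.  The sum over all sets `R` of
edges then factorizes, every edge of `P ∩ Q` contributing the factor `0`, and gives the weights of
the mixed contour expansion (`sum_character_mul_doubleWeight`, `sum_doubleWeight_symmDiff_eq`).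
Euler's formula turns the power of `2` into `|F| + 2g + 1`.  Summing over `P` gives the partition
function, and dividing by it the law of the XOR loop configuration.
-/

namespace CellularEmbedding

/-! ### Homology classes of polygon configurations as cosets of boundaries -/

theorem chain_symmDiff {E : Type*} [DecidableEq E] (P Q : Finset E) :
    chain (symmDiff P Q) = chain P + chain Q := by
  funext e
  simp only [chain, Finset.mem_symmDiff, Pi.add_apply]
  by_cases hP : e ∈ P <;> by_cases hQ : e ∈ Q <;> simp [hP, hQ]
  decide

/-- Domain walls are the boundaries of 2-chains, for the identification of `{1, -1}` with
`ℤ/2ℤ`. -/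
theorem exists_domainWall_iff {V E F : Type*} [Fintype E] [DecidableEq E]
    (M : CellularEmbedding V E F) (P : Finset E) :
    (∃ s, M.domainWall s = P) ↔ ∃ c, M.boundaryTwo c = chain P := by
  constructor
  · rintro ⟨s, rfl⟩
    refine ⟨fun f => if s f = 1 then 0 else 1, ?_⟩
    funext e
    simp only [boundaryTwo, LinearMap.coe_mk, AddHom.coe_mk, chain, domainWall, Finset.mem_filter,
      Finset.mem_univ, true_and]
    rcases Int.units_eq_one_or (s (M.face (e, false))) with h | h <;>
      rcases Int.units_eq_one_or (s (M.face (e, true))) with h' | h' <;> rw [h, h'] <;> decide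
  · rintro ⟨c, hc⟩
    refine ⟨fun f => if c f = 0 then 1 else -1, ?_⟩
    ext e
    have h := congrFun hc e
    simp only [boundaryTwo, LinearMap.coe_mk, AddHom.coe_mk, chain] at h
    simp only [domainWall, Finset.mem_filter, Finset.mem_univ, true_and]
    generalize c (M.face (e, false)) = a at *
    generalize c (M.face (e, true)) = b at *
    by_cases he : e ∈ P
    · simp only [he, if_true, iff_true] at h ⊢
      revert a b; decide
    · simp only [he, if_false, iff_false] at h ⊢
      revert a b; decide

section Chains

variable {V E F : Type*} [Fintype E] [DecidableEq V] [DecidableEq E]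

theorem boundaryOne_chain (M : CellularEmbedding V E F) (P : Finset E) (v : V) :
    M.boundaryOne (chain P) v
      = ((Finset.card {d : E × Bool | M.origin d = v ∧ d.1 ∈ P} : ℕ) : ZMod 2) := by
  rw [Finset.natCast_card_filter]
  refine Finset.sum_congr rfl fun d _ => ?_
  rw [ite_and]
  rfl

theorem isPolygon_iff (M : CellularEmbedding V E F) (P : Finset E) :
    M.IsPolygon P ↔ M.boundaryOne (chain P) = 0 := by
  refine ⟨fun h => h.chain_mem_ker, fun h v => ?_⟩
  rw [← ZMod.natCast_eq_zero_iff_even, ← boundaryOne_chain, h]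
  rfl

theorem homologyClass_eq_iff {M : CellularEmbedding V E F} {P Q : Finset E}
    (hP : M.IsPolygon P) (hQ : M.IsPolygon Q) :
    hP.homologyClass = hQ.homologyClass ↔ ∃ c, M.boundaryTwo c = chain (symmDiff P Q) := by
  have h : chain (symmDiff P Q) = chain P - chain Q := by
    rw [chain_symmDiff]
    funext e
    exact (CharTwo.sub_eq_add _ _).symm
  rw [IsPolygon.homologyClass, IsPolygon.homologyClass, Submodule.Quotient.eq, h]
  rfl

theorem mem_polygons {M : CellularEmbedding V E F} {ε : M.Homology} {P : Finset E} :
    P ∈ M.polygons ε ↔ ∃ h : M.IsPolygon P, h.homologyClass = ε := by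
  simp [polygons]

theorem isPolygon_empty (M : CellularEmbedding V E F) : M.IsPolygon ∅ := by
  intro v
  simp

theorem empty_mem_polygons_zero (M : CellularEmbedding V E F) : ∅ ∈ M.polygons 0 := by
  refine mem_polygons.2 ⟨M.isPolygon_empty, ?_⟩
  rw [IsPolygon.homologyClass, Submodule.Quotient.mk_eq_zero]
  exact ⟨0, by funext e; simp [chain]⟩

/-- The class `ε` is the coset of any of its elements `D` under boundaries of 2-chains. -/
theorem mem_polygons_iff_boundaryTwo {M : CellularEmbedding V E F} {ε : M.Homology}
    {D P : Finset E} (hD : D ∈ M.polygons ε) :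
    P ∈ M.polygons ε ↔ ∃ c, M.boundaryTwo c = chain (symmDiff P D) := by
  obtain ⟨hD₁, rfl⟩ := mem_polygons.1 hD
  rw [mem_polygons]
  constructor
  · rintro ⟨hP, h⟩
    exact (homologyClass_eq_iff hP hD₁).1 h
  · rintro ⟨c, hc⟩
    have hP : M.IsPolygon P := by
      have h := M.boundaryOne_boundaryTwo c
      rwa [hc, chain_symmDiff, map_add, (M.isPolygon_iff D).1 hD₁, add_zero,
        ← isPolygon_iff] at h
    exact ⟨hP, (homologyClass_eq_iff hP hD₁).2 ⟨c, hc⟩⟩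

/-- The low-temperature configurations with defect set `D` are the polygon configurations homologous
to `D`. -/
theorem mem_polygons_iff_lowTemp {M : CellularEmbedding V E F} {ε : M.Homology}
    {D P : Finset E} (hD : D ∈ M.polygons ε) :
    P ∈ M.polygons ε ↔ ∃ s, M.lowTemp D s = P := by
  rw [mem_polygons_iff_boundaryTwo hD, ← exists_domainWall_iff]
  refine exists_congr fun s => ⟨?_, ?_⟩
  · intro h
    rw [lowTemp, h, symmDiff_symmDiff_cancel_right]
  · rintro rfl
    rw [lowTemp, symmDiff_symmDiff_cancel_right]

end Chains

/-! ### Domain walls and the low-temperature map -/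

theorem mem_domainWall {V E F : Type*} [Fintype E] {M : CellularEmbedding V E F} {s : F → ℤˣ}
    {e : E} : e ∈ M.domainWall s ↔ s (M.face (e, false)) ≠ s (M.face (e, true)) := by
  simp [domainWall]

/-- On a connected surface, only the constant spin configurations have no domain wall. -/
theorem domainWall_eq_empty_iff {V E F : Type*} [Fintype E]
    (M : CellularEmbedding V E F) (s : F → ℤˣ) :
    M.domainWall s = ∅ ↔ s = 1 ∨ s = -1 := by
  constructor
  · intro h
    have h1 : ∀ d, s (M.face d) = s (M.face (dartFlip E d)) := by
      have h2 : ∀ e, s (M.face (e, false)) = s (M.face (e, true)) := fun e => by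
        by_contra h3
        simpa [h] using mem_domainWall.2 h3
      rintro ⟨e, _ | _⟩
      · exact h2 e
      · exact (h2 e).symm
    have h3 : ∀ f f', s f = s f' := fun f f' => by
      obtain ⟨w⟩ := M.dual_connected.preconnected f f'
      induction w with
      | nil => rfl
      | cons hadj _ ih =>
        rw [← ih]
        rcases hadj.2 with ⟨d, rfl, rfl⟩ | ⟨d, rfl, rfl⟩
        · exact h1 d
        · exact (h1 d).symm
    obtain ⟨f⟩ := M.dual_connected.nonempty
    rcases Int.units_eq_one_or (s f) with h4 | h4
    · exact Or.inl (funext fun f' => (h3 f' f).trans h4)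
    · exact Or.inr (funext fun f' => (h3 f' f).trans h4)
  · rintro (rfl | rfl) <;> ext e <;> simp [mem_domainWall]

section Spins

variable {V E F : Type*} [Fintype E] [DecidableEq E]

theorem domainWall_mul (M : CellularEmbedding V E F) (s t : F → ℤˣ) :
    M.domainWall (s * t) = symmDiff (M.domainWall s) (M.domainWall t) := by
  ext e
  simp only [Finset.mem_symmDiff, mem_domainWall, Pi.mul_apply]
  generalize s _ = a, s _ = b, t _ = c, t _ = d
  revert a b c d; decide

/-- The low-temperature configuration determines the spins up to a global change of sign. -/
theorem lowTemp_eq_iff (M : CellularEmbedding V E F) (D : Finset E) (s t : F → ℤˣ) :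
    M.lowTemp D s = M.lowTemp D t ↔ s = t ∨ s = -t := by
  have htt : t * t = 1 := funext fun f => Int.units_mul_self (t f)
  have h : s * t = 1 ↔ s = t := by
    rw [← mul_left_inj t, mul_assoc, htt, mul_one, one_mul]
  have h' : s * t = -1 ↔ s = -t := by
    rw [← mul_left_inj t, mul_assoc, htt, mul_one, neg_one_mul]
  rw [lowTemp, lowTemp, symmDiff_left_inj, ← symmDiff_eq_bot, ← domainWall_mul, ← h, ← h']
  exact M.domainWall_eq_empty_iff (s * t)

end Spins

/-! ### Summation over spin configurations -/

/-- The character of `R` attached to the spins at the vertices only depends on their domain wall in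
the dual map. -/
theorem prod_spins_eq_prod_dual_domainWall {V E F : Type*} [Fintype E] [DecidableEq E]
    (M : CellularEmbedding V E F) (s : V → ℤˣ) (R : Finset E) :
    ∏ e ∈ R, ((s (M.origin (e, false)) * s (M.origin (e, true)) : ℤˣ) : ℤ)
      = ∏ e ∈ R, if e ∈ M.dual.domainWall s then -1 else 1 := by
  refine Finset.prod_congr rfl fun e _ => ?_
  simp only [mem_domainWall]
  change _ = if s (M.origin (e, false)) ≠ s (M.origin (e, true)) then _ else _
  generalize s _ = a, s _ = b
  revert a b; decide

section Counting

variable {V E F : Type*} [Fintype E] [DecidableEq V] [DecidableEq E]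

/-- The low-temperature expansion is two-to-one onto the polygon configurations of the class of the
defect set: the two preimages differ by a global change of sign. -/
theorem sum_lowTemp [Fintype F] [DecidableEq F] (M : CellularEmbedding V E F) {ε : M.Homology}
    {D : Finset E} (hD : D ∈ M.polygons ε) (h : Finset E → ℝ) :
    ∑ s : F → ℤˣ, h (M.lowTemp D s) = 2 * ∑ P ∈ M.polygons ε, h P := by
  rw [← Finset.sum_fiberwise_of_maps_to (t := M.polygons ε) (g := M.lowTemp D)
    (fun s _ => (mem_polygons_iff_lowTemp hD).2 ⟨s, rfl⟩), Finset.mul_sum]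
  refine Finset.sum_congr rfl fun P hP => ?_
  obtain ⟨s, rfl⟩ := (mem_polygons_iff_lowTemp hD).1 hP
  have h1 : (Finset.univ.filter fun t => M.lowTemp D t = M.lowTemp D s) = {s, -s} := by
    ext t
    simp [lowTemp_eq_iff]
  have h2 : s ≠ -s := fun h3 => by
    obtain ⟨f⟩ := M.dual_connected.nonempty
    have h4 := congrFun h3 f
    rw [Pi.neg_apply] at h4
    revert h4
    generalize s f = a
    revert a; decide
  rw [h1, Finset.sum_pair h2]
  have h3 : M.lowTemp D (-s) = M.lowTemp D s := (M.lowTemp_eq_iff D _ _).2 (Or.inr rfl)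
  rw [h3]
  ring

theorem sum_domainWall [Fintype F] [DecidableEq F] (M : CellularEmbedding V E F)
    (h : Finset E → ℝ) :
    ∑ s : F → ℤˣ, h (M.domainWall s) = 2 * ∑ P ∈ M.polygons 0, h P := by
  rw [← M.sum_lowTemp M.empty_mem_polygons_zero]
  refine Finset.sum_congr rfl fun s _ => ?_
  rw [lowTemp, ← Finset.bot_eq_empty, symmDiff_bot]

/-- The low-temperature expansion of the Ising model with defects. -/
theorem isingPartition_eq [Fintype F] [DecidableEq F] (M : CellularEmbedding V E F) (J : E → ℝ)
    {ε : M.Homology} {D : Finset E} (hD : D ∈ M.polygons ε) :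
    M.isingPartition J D = (2 * ∏ e : E, Real.exp (J e)) *
      ∑ P ∈ M.polygons ε, ∏ e ∈ P, Real.exp (-2 * J e) := by
  have h : ∀ s : F → ℤˣ, Real.exp (∑ e : E, (if e ∈ D then -J e else J e) *
      ((s (M.face (e, false)) : ℤ) : ℝ) * ((s (M.face (e, true)) : ℤ) : ℝ))
      = (∏ e : E, Real.exp (J e)) * ∏ e ∈ M.lowTemp D s, Real.exp (-2 * J e) := fun s => by
    rw [Real.exp_sum, ← Finset.univ_inter (M.lowTemp D s), ← Finset.prod_ite_mem,
      ← Finset.prod_mul_distrib]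
    refine Finset.prod_congr rfl fun e _ => ?_
    have hJ : Real.exp (-J e) = Real.exp (J e) * Real.exp (-2 * J e) := by
      rw [← Real.exp_add]; ring_nf
    simp only [lowTemp, Finset.mem_symmDiff, mem_domainWall]
    rcases Int.units_eq_one_or (s (M.face (e, false))) with h | h <;>
      rcases Int.units_eq_one_or (s (M.face (e, true))) with h' | h' <;> rw [h, h'] <;>
      by_cases he : e ∈ D <;> simp [he, hJ]
  rw [isingPartition, Finset.sum_congr rfl fun s _ => h s, ← Finset.mul_sum,
    M.sum_lowTemp hD (fun P => ∏ e ∈ P, Real.exp (-2 * J e))]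
  ring

/-- The orthogonality relation behind the duality: the product of the spins at the ends of the edges
of `R`, summed over the spins at the vertices, detects the polygon configurations. -/
theorem sum_prod_spins [Fintype V] (M : CellularEmbedding V E F) (R : Finset E)
    [Decidable (M.IsPolygon R)] :
    ∑ s : V → ℤˣ, ∏ e ∈ R, ((s (M.origin (e, false)) * s (M.origin (e, true)) : ℤˣ) : ℤ)
      = if M.IsPolygon R then 2 ^ Fintype.card V else 0 := by
  have h1 : ∀ s : V → ℤˣ,
      ∏ e ∈ R, ((s (M.origin (e, false)) * s (M.origin (e, true)) : ℤˣ) : ℤ)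
      = ∏ v, ((s v : ℤˣ) : ℤ) ^ Finset.card {d : E × Bool | M.origin d = v ∧ d.1 ∈ R} := by
    intro s
    have h2 : ∏ e ∈ R, ((s (M.origin (e, false)) * s (M.origin (e, true)) : ℤˣ) : ℤ)
        = ∏ d ∈ R ×ˢ (Finset.univ : Finset Bool), (s (M.origin d) : ℤ) := by
      rw [Finset.prod_product]
      refine Finset.prod_congr rfl fun e _ => ?_
      rw [Fintype.prod_bool, Units.val_mul, mul_comm]
    -- Grouping the darts of the edges of `R` by their origin.
    rw [h2, ← Finset.prod_fiberwise (R ×ˢ (Finset.univ : Finset Bool)) M.origin]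
    refine Finset.prod_congr rfl fun v _ => ?_
    rw [Finset.prod_congr rfl (g := fun _ => (s v : ℤ)), Finset.prod_const]
    · congr 2
      ext d
      simp [and_comm]
    · intro d hd
      rw [(Finset.mem_filter.1 hd).2]
  have h3 : ∀ n : ℕ, ∑ x : ℤˣ, (x : ℤ) ^ n = if Even n then 2 else 0 := by
    intro n
    rw [UnitsInt.univ, Finset.sum_pair (by decide)]
    rcases n.even_or_odd with h | h
    · simp [h]
    · simp [h.neg_one_pow, Nat.not_even_iff_odd.2 h]
  rw [Finset.sum_congr rfl fun s _ => h1 s, ← Fintype.piFinset_univ,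
    ← Finset.prod_univ_sum (fun _ => Finset.univ) (fun v (x : ℤˣ) =>
      (x : ℤ) ^ Finset.card {d : E × Bool | M.origin d = v ∧ d.1 ∈ R})]
  simp only [h3]
  split_ifs with h
  · rw [Finset.prod_congr rfl fun v _ => if_pos (h v), Finset.prod_const, Finset.card_univ]
  · obtain ⟨v, hv⟩ := not_forall.1 h
    exact Finset.prod_eq_zero (Finset.mem_univ v) (if_neg hv)

end Counting

/-! ### Fourier transform of the double Ising weight -/

/-- The discrete Fourier transform of the weight of the pairs with symmetric difference `P`. -/
theorem sum_character_mul_doubleWeight {E : Type*} [Fintype E] [DecidableEq E] (J : E → ℝ)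
    (P Q : Finset E) :
    ∑ R : Finset E, (∏ e ∈ R, if e ∈ Q then (-1 : ℝ) else 1) * doubleWeight J (R, symmDiff R P)
      = 2 ^ (Fintype.card E + 2) * (∏ e : E, Real.cosh (2 * J e)) *
        if Disjoint P Q then primalWeight J P * dualWeight J Q else 0 := by
  set x : E → ℝ := fun e => Real.exp (-2 * J e) with hx
  have hx4 : ∀ e, Real.exp (-4 * J e) = x e ^ 2 := fun e => by
    rw [hx, ← Real.exp_nat_mul]; ring_nf
  have hpos : ∀ e, 1 + x e ^ 2 ≠ 0 := fun e => by positivity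
  -- The factors at the edges inside and outside `R`, so that the sum over `R` becomes a product of
  -- two-term sums by `Finset.prod_add`.
  have hR : ∀ R : Finset E, (∏ e ∈ R, if e ∈ Q then (-1 : ℝ) else 1) *
      doubleWeight J (R, symmDiff R P) = (2 * ∏ e : E, Real.exp (J e)) ^ 2 *
      ((∏ e ∈ R, (if e ∈ Q then (-1 : ℝ) else 1) * x e * (if e ∈ P then 1 else x e)) *
        ∏ e ∈ Finset.univ \ R, if e ∈ P then x e else 1) := fun R => by
    have h1 : ∏ e ∈ symmDiff R P, x e
        = (∏ e ∈ R, if e ∈ P then 1 else x e) * ∏ e ∈ Finset.univ \ R, if e ∈ P then x e else 1 := by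
      rw [symmDiff_def, Finset.sup_eq_union, Finset.prod_union disjoint_sdiff_sdiff]
      congr 1
      · simp [Finset.prod_ite, Finset.sdiff_eq_filter]
      · rw [Finset.prod_ite_mem]
        congr 1
        ext e
        simp [and_comm]
    rw [doubleWeight, h1, Finset.prod_mul_distrib, Finset.prod_mul_distrib]
    ring
  have hcosh : (2 * ∏ e : E, Real.exp (J e)) ^ 2 * ∏ e : E, (1 + x e ^ 2)
      = 2 ^ (Fintype.card E + 2) * ∏ e : E, Real.cosh (2 * J e) := by
    have h1 : ∀ e, Real.exp (J e) ^ 2 * (1 + x e ^ 2) = 2 * Real.cosh (2 * J e) := fun e => by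
      rw [Real.cosh_eq, ← hx4, mul_add, ← Real.exp_nat_mul, ← Real.exp_add]
      ring_nf
    rw [mul_pow, ← Finset.prod_pow, mul_assoc, ← Finset.prod_mul_distrib,
      Finset.prod_congr rfl fun e _ => h1 e, Finset.prod_mul_distrib, Finset.prod_const,
      Finset.card_univ]
    ring
  rw [Finset.sum_congr rfl fun R _ => hR R, ← Finset.mul_sum, ← Finset.powerset_univ,
    ← Finset.prod_add, ← hcosh, mul_assoc]
  congr 1
  split_ifs with hd
  · rw [primalWeight, dualWeight, ← Finset.univ_inter P, ← Finset.univ_inter Q,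
      ← Finset.prod_ite_mem, ← Finset.prod_ite_mem, ← Finset.prod_mul_distrib,
      ← Finset.prod_mul_distrib, Finset.univ_inter, Finset.univ_inter]
    refine Finset.prod_congr rfl fun e _ => ?_
    have := hpos e
    have : e ∈ P → e ∉ Q := fun h => Finset.disjoint_left.1 hd h
    rw [hx4]
    by_cases hP : e ∈ P <;> by_cases hQ : e ∈ Q <;> simp_all <;> field_simp <;> ring
  · -- At an edge of `P ∩ Q` the two states of `R` have opposite contributions.
    obtain ⟨e, hP, hQ⟩ := Finset.not_disjoint_iff.1 hd
    rw [mul_zero]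
    exact Finset.prod_eq_zero (Finset.mem_univ e) (by simp [hP, hQ])

/-! ### Pairs of polygon configurations and XOR loops -/

section Pairs

variable {V E F : Type*} [Fintype E] [DecidableEq V] [DecidableEq E]

theorem mem_doublePairs {M : CellularEmbedding V E F} {p : Finset E × Finset E} :
    p ∈ M.doublePairs ↔ ∃ ε, p.1 ∈ M.polygons ε ∧ p.2 ∈ M.polygons ε := by
  simp [doublePairs]

/-- The second component of a pair is recovered from the first and the symmetric difference, which
is an arbitrary boundary. -/
theorem mem_doublePairs_iff_symmDiff {M : CellularEmbedding V E F} {p : Finset E × Finset E} :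
    p ∈ M.doublePairs ↔ M.IsPolygon p.1 ∧ symmDiff p.1 p.2 ∈ M.polygons 0 := by
  have h0 : symmDiff p.1 p.2 ∈ M.polygons 0 ↔ ∃ c, M.boundaryTwo c = chain (symmDiff p.2 p.1) := by
    rw [mem_polygons_iff_boundaryTwo M.empty_mem_polygons_zero, ← Finset.bot_eq_empty,
      symmDiff_bot, symmDiff_comm]
  rw [mem_doublePairs, h0]
  constructor
  · rintro ⟨ε, h1, h2⟩
    exact ⟨(mem_polygons.1 h1).1, (mem_polygons_iff_boundaryTwo h1).1 h2⟩
  · rintro ⟨h1, h2⟩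
    have h3 : p.1 ∈ M.polygons h1.homologyClass := mem_polygons.2 ⟨h1, rfl⟩
    exact ⟨_, h3, (mem_polygons_iff_boundaryTwo h3).2 h2⟩

/-- The XOR loop configuration does not see the chosen representatives: they cancel in the symmetric
difference of the two low-temperature configurations. -/
theorem isXorLoop_iff {M : CellularEmbedding V E F} {rep : M.Homology → Finset E}
    (hrep : ∀ ε, rep ε ∈ M.polygons ε) {p : Finset E × Finset E} {P : Finset E} :
    M.IsXorLoop rep p P ↔ p ∈ M.doublePairs ∧ symmDiff p.1 p.2 = P := by
  have h : ∀ (D : Finset E) (s t : F → ℤˣ),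
      M.domainWall (s * t) = symmDiff (M.lowTemp D s) (M.lowTemp D t) := fun D s t => by
    rw [domainWall_mul, lowTemp, lowTemp, symmDiff_symmDiff_symmDiff_comm, symmDiff_self,
      symmDiff_bot]
  constructor
  · rintro ⟨ε, h1, h2, s, t, hs, ht, rfl⟩
    exact ⟨mem_doublePairs.2 ⟨ε, h1, h2⟩, by rw [h (rep ε), hs, ht]⟩
  · rintro ⟨hp, rfl⟩
    obtain ⟨ε, h1, h2⟩ := mem_doublePairs.1 hp
    obtain ⟨s, hs⟩ := (mem_polygons_iff_lowTemp (hrep ε)).1 h1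
    obtain ⟨t, ht⟩ := (mem_polygons_iff_lowTemp (hrep ε)).1 h2
    exact ⟨ε, h1, h2, s, t, hs, ht, by rw [h (rep ε), hs, ht]⟩

theorem doublePartition_eq_sum_doublePairs (M : CellularEmbedding V E F) (J : E → ℝ) :
    M.doublePartition J = ∑ p ∈ M.doublePairs, doubleWeight J p := by
  rw [doublePartition, doublePairs, Finset.sum_biUnion]
  intro ε _ ε' _ hne
  refine Finset.disjoint_left.2 fun p h h' => hne ?_
  obtain ⟨_, h1⟩ := mem_polygons.1 (Finset.mem_product.1 h).1
  obtain ⟨_, h2⟩ := mem_polygons.1 (Finset.mem_product.1 h').1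
  exact h1.symm.trans h2

/-- The mixed contour expansion with the primal contour `P` fixed: the total weight of the pairs
with symmetric difference `P`. -/
theorem sum_doubleWeight_symmDiff_eq [Fintype V] [Fintype F] [DecidableEq F]
    {M : CellularEmbedding V E F} {g : ℕ} (hg : M.HasGenus g) (J : E → ℝ) {P : Finset E}
    (hP : P ∈ M.polygons 0) :
    ∑ p ∈ M.doublePairs with symmDiff p.1 p.2 = P, doubleWeight J p
      = (2 ^ (Fintype.card F + 2 * g + 1) * ∏ e : E, Real.cosh (2 * J e)) *
        (primalWeight J P * ∑ Q ∈ M.dual.polygons 0 with Disjoint P Q, dualWeight J Q) := by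
  classical
  have h1 : ∑ p ∈ M.doublePairs with symmDiff p.1 p.2 = P, doubleWeight J p
      = ∑ R : Finset E with M.IsPolygon R, doubleWeight J (R, symmDiff R P) := by
    refine Finset.sum_bij' (fun p _ => p.1) (fun R _ => (R, symmDiff R P)) ?_ ?_ ?_ ?_ ?_
    · intro p hp
      rw [Finset.mem_filter, mem_doublePairs_iff_symmDiff] at hp
      simpa using hp.1.1
    · intro R hR
      rw [Finset.mem_filter, mem_doublePairs_iff_symmDiff]
      simpa [symmDiff_symmDiff_cancel_left] using ⟨(Finset.mem_filter.1 hR).2, hP⟩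
    · intro p hp
      rw [Finset.mem_filter] at hp
      rw [← hp.2, symmDiff_symmDiff_cancel_left]
    · intro R _
      rfl
    · intro p hp
      rw [Finset.mem_filter] at hp
      rw [← hp.2, symmDiff_symmDiff_cancel_left]
  have h2 : (2 : ℝ) ^ Fintype.card V *
      ∑ R : Finset E with M.IsPolygon R, doubleWeight J (R, symmDiff R P)
      = ∑ s : V → ℤˣ, ∑ R : Finset E,
        (∏ e ∈ R, if e ∈ M.dual.domainWall s then (-1 : ℝ) else 1) *
          doubleWeight J (R, symmDiff R P) := by
    rw [Finset.sum_comm, Finset.sum_filter, Finset.mul_sum]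
    refine Finset.sum_congr rfl fun R _ => ?_
    have h3 := M.sum_prod_spins R
    simp only [prod_spins_eq_prod_dual_domainWall] at h3
    have h4 := congrArg (Int.cast : ℤ → ℝ) h3
    push_cast at h4
    rw [← Finset.sum_mul, h4]
    split_ifs <;> simp
  -- Euler's formula; the `3` comes from the constant `2 ^ 2` in the weight and from the two spin
  -- configurations with a given domain wall.
  have hcard : Fintype.card E + 3 = Fintype.card V + (Fintype.card F + 2 * g + 1) := by
    unfold HasGenus at hg
    omega
  have hV : (2 : ℝ) ^ Fintype.card V ≠ 0 := by positivity
  refine mul_left_cancel₀ hV ?_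
  rw [h1, h2, Finset.sum_congr rfl fun s _ =>
    sum_character_mul_doubleWeight J P (M.dual.domainWall s), ← Finset.mul_sum,
    M.dual.sum_domainWall (fun Q => if Disjoint P Q then primalWeight J P * dualWeight J Q else 0),
    ← Finset.sum_filter, ← Finset.mul_sum]
  calc _ = 2 ^ (Fintype.card E + 3) * (∏ e : E, Real.cosh (2 * J e)) * (primalWeight J P *
        ∑ Q ∈ M.dual.polygons 0 with Disjoint P Q, dualWeight J Q) := by ring
    _ = _ := by rw [hcard]; ring

theorem mixedSum_eq [DecidableEq F] (M : CellularEmbedding V E F) (J : E → ℝ) :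
    M.mixedSum J = ∑ P ∈ M.polygons 0,
      primalWeight J P * ∑ Q ∈ M.dual.polygons 0 with Disjoint P Q, dualWeight J Q := by
  rw [mixedSum, Finset.sum_filter, Finset.sum_product]
  refine Finset.sum_congr rfl fun P _ => ?_
  rw [Finset.mul_sum, Finset.sum_filter]

end Pairs

end CellularEmbedding

theorem mainTheorem2 {V E F : Type*} [Fintype V] [Fintype E] [Fintype F]
    [DecidableEq V] [DecidableEq E] [DecidableEq F]
    (M : CellularEmbedding V E F) (g : ℕ) (hg : M.HasGenus g)
    (J : E → ℝ) (hJ : ∀ e, 0 < J e)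
    (rep : M.Homology → Finset E) (hrep : ∀ ε, rep ε ∈ M.polygons ε) :
    -- the double Ising partition function in terms of the Ising models with defects
    M.doublePartition J = ∑ ε : M.Homology, M.isingPartition J (rep ε) ^ 2 ∧
    -- the mixed contour expansion
    M.doublePartition J =
      (2 ^ (Fintype.card F + 2 * g + 1) * ∏ e : E, Real.cosh (2 * J e)) * M.mixedSum J ∧
    -- the XOR loop configuration is well defined, and its values are the elements of `𝒫⁰(G)`
    (∀ p ∈ M.doublePairs, ∃! P, M.IsXorLoop rep p P) ∧
    (∀ P, (∃ p ∈ M.doublePairs, M.IsXorLoop rep p P) ↔ P ∈ M.polygons 0) ∧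
    -- the law of the XOR loop configuration
    ∀ P ∈ M.polygons 0, M.xorProb J rep P =
      (CellularEmbedding.primalWeight J P *
        ∑ Q ∈ M.dual.polygons 0 with Disjoint P Q, CellularEmbedding.dualWeight J Q) / M.mixedSum J := by
  classical
  have hZ : M.doublePartition J =
      (2 ^ (Fintype.card F + 2 * g + 1) * ∏ e : E, Real.cosh (2 * J e)) * M.mixedSum J := by
    rw [M.doublePartition_eq_sum_doublePairs, M.mixedSum_eq, Finset.mul_sum,
      ← Finset.sum_fiberwise_of_maps_to (t := M.polygons 0) (g := fun p => symmDiff p.1 p.2)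
        fun p hp => (CellularEmbedding.mem_doublePairs_iff_symmDiff.1 hp).2]
    exact Finset.sum_congr rfl fun P hP =>
      CellularEmbedding.sum_doubleWeight_symmDiff_eq hg J hP
  refine ⟨?_, hZ, ?_, ?_, ?_⟩
  · refine Finset.sum_congr rfl fun ε _ => ?_
    rw [M.isingPartition_eq J (hrep ε), mul_pow, sq (∑ P ∈ M.polygons ε, _), Finset.sum_mul_sum,
      Finset.sum_product, Finset.mul_sum]
    refine Finset.sum_congr rfl fun R _ => ?_
    rw [Finset.mul_sum]
    refine Finset.sum_congr rfl fun B _ => ?_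
    rw [CellularEmbedding.doubleWeight, mul_assoc]
  · intro p hp
    exact ⟨symmDiff p.1 p.2, (CellularEmbedding.isXorLoop_iff hrep).2 ⟨hp, rfl⟩,
      fun P h => ((CellularEmbedding.isXorLoop_iff hrep).1 h).2.symm⟩
  · intro P
    constructor
    · rintro ⟨p, hp, h⟩
      rw [← ((CellularEmbedding.isXorLoop_iff hrep).1 h).2]
      exact (CellularEmbedding.mem_doublePairs_iff_symmDiff.1 hp).2
    · intro hP
      have hp : (P, ∅) ∈ M.doublePairs :=
        CellularEmbedding.mem_doublePairs.2 ⟨0, hP, M.empty_mem_polygons_zero⟩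
      refine ⟨_, hp, (CellularEmbedding.isXorLoop_iff hrep).2 ⟨hp, ?_⟩⟩
      exact symmDiff_bot P
  · intro P hP
    have hC : (2 : ℝ) ^ (Fintype.card F + 2 * g + 1) * ∏ e : E, Real.cosh (2 * J e) ≠ 0 :=
      mul_ne_zero (by positivity) (Finset.prod_ne_zero_iff.2 fun e _ => (Real.cosh_pos _).ne')
    have hfilter : (M.doublePairs.filter fun p => M.IsXorLoop rep p P)
        = M.doublePairs.filter fun p => symmDiff p.1 p.2 = P :=
      Finset.filter_congr fun p hp => by
        rw [CellularEmbedding.isXorLoop_iff hrep, and_iff_right hp]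
    rw [← mul_div_mul_left _ _ hC, ← hZ, ← CellularEmbedding.sum_doubleWeight_symmDiff_eq hg J hP,
      Finset.sum_div, ← hfilter, CellularEmbedding.xorProb]
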